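/- We write $\pi=\pi(1)\cdots\pi(n)$ for a permutation of length $n\ge 0$. \emph{Geometric grid classes.} Let $M$ be a $0/{\pm}1$ matrix with entries $M(k,\ell)$, indexed in Cartesian coordinates ($k$ is the column, counted from left to right, and $\ell$ is the row, counted from bottom to top, both starting at $1$). The \emph{standard figure} $\Lambda_M\subseteq\mathbb{R}^2$ is the union of the line segments from $(k-1,\ell-1)$ to $(k,\ell)$ over all $(k,\ell)$ with $M(k,\ell)=1$ and the line segments from $(k-1,\ell)$ to $(k,\ell-1)$ over all $(k,\ell)$ with $M(k,\ell)=-1$. A set of points in the plane is \emph{independent} if no two of its points lie on a common horizontal or vertical line. The \emph{geometric grid class} $\operatorname{Geom}(M)$ is the set of all permutations $\pi$ whose plot $\{(i,\pi(i)) : 1\le i\le n\}$ is in the same relative order as some finite independent subset of $\Lambda_M$; here two point sets are in the same relative order if one can be transformed into the other by applying an increasing bijection $\mathbb{R}\to\mathbb{R}$ to each of the two coordinates. \emph{Labeled well-quasi-order.} A quasi-order $(X,\le)$ is \emph{wqo} if for every infinite sequence $x_1,x_2,\dots$ in $X$ there are $i<j$ with $x_i\le x_j$. For a quasi-order $(L,\le_L)$,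 an \emph{$L$-labeled permutation} is a pair $(\pi,\ell_\pi)$ where $\pi$ is a permutation, of length $n$ say, and $\ell_\pi$ is a map $\{1,\dots,n\}\to L$. An $L$-labeled permutation $(\sigma,\ell_\sigma)$, with $\sigma$ of length $m$, is \emph{contained} in $(\pi,\ell_\pi)$ if there are indices $1\le i_1<\cdots<i_m\le n$ such that $\pi(i_1)\cdots\pi(i_m)$ is order isomorphic to $\sigma$ and $\ell_\sigma(j)\le_L\ell_\pi(i_j)$ for all $1\le j\le m$. A set $\mathcal{C}$ of permutations is \emph{labeled well-quasi-ordered (lwqo)} if, for every wqo $(L,\le_L)$, the set of all $L$-labeled permutations $(\pi,\ell_\pi)$ with $\pi\in\mathcal{C}$ is wqo under this containment order. \textbf{Theorem.} For every $0/{\pm}1$ matrix $M$, the geometric grid class $\operatorname{Geom}(M)$ is lwqo. -/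

import Mathlib

universe u

namespace GeomGrid

/-- Permutations of all finite lengths: a length `n` together with a permutation of `Fin n`
(positions and values are numbered from `0`). -/
abbrev FinPerm : Type := Σ n : ℕ, Equiv.Perm (Fin n)

/-! ### Labeled permutations and labeled well-quasi-order -/

/-- An `L`-labeled permutation: a permutation together with a map from its indices to `L`. -/
structure LabeledPerm (L : Type u) where
  toPerm : FinPerm
  label : Fin toPerm.1 → L

/-- Containment of labeled permutations: there is an increasing choice `e` of indices of `y` such
that the corresponding subsequence of `y` is order isomorphic to `x` and each label of `x` is at
most the label of the entry of `y` that plays its role. -/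
def LabeledPerm.Contained {L : Type u} [LE L] (x y : LabeledPerm L) : Prop :=
  ∃ e : Fin x.toPerm.1 ↪o Fin y.toPerm.1,
    (∀ i j, x.toPerm.2 i < x.toPerm.2 j ↔ y.toPerm.2 (e i) < y.toPerm.2 (e j)) ∧
      ∀ j, x.label j ≤ y.label (e j)

/-- Labeled containment is a quasi-order. -/
instance {L : Type u} [Preorder L] : Preorder (LabeledPerm L) where
  le := LabeledPerm.Contained
  le_refl _ := ⟨RelEmbedding.refl _, fun _ _ => Iff.rfl, fun _ => le_rfl⟩
  le_trans := by
    rintro x y z ⟨e, he, hel⟩ ⟨f, hf, hfl⟩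
    exact ⟨e.trans f, fun i j => (he i j).trans (hf (e i) (e j)),
      fun j => (hel j).trans (hfl (e j))⟩

/-- The set of all `L`-labeled permutations whose underlying permutation lies in `C`. -/
def labeledBy (C : Set FinPerm) (L : Type u) : Set (LabeledPerm L) :=
  {x | x.toPerm ∈ C}

/-- `C` is labeled well-quasi-ordered: for every quasi-order `L` that is wqo, the `L`-labeled
members of `C` are wqo under labeled containment. -/
def IsLWQO (C : Set FinPerm) : Prop :=
  ∀ (L : Type u) [Preorder L] [WellQuasiOrderedLE L], WellQuasiOrderedLE (labeledBy C L)

/-! ### Geometric grid classes -/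

/-- No two points of the set lie on a common horizontal or vertical line. -/
def Independent (S : Set (ℝ × ℝ)) : Prop :=
  Set.InjOn Prod.fst S ∧ Set.InjOn Prod.snd S

/-- Two point sets have the same relative order if one can be transformed into the other by
stretching and shrinking the two axes, that is, by an increasing bijection of each axis. -/
def SameRelativeOrder (S T : Set (ℝ × ℝ)) : Prop :=
  ∃ f g : ℝ ≃o ℝ, Prod.map f g '' S = T

/-- The plot of a permutation: the points `(i, π(i))` with `1 ≤ i ≤ n`. -/
def plot (π : FinPerm) : Set (ℝ × ℝ) :=
  Set.range fun i : Fin π.1 => (((i : ℕ) : ℝ) + 1, ((π.2 i : ℕ) : ℝ) + 1)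

/-- The standard figure of a `0/±1` matrix. The matrix is indexed in Cartesian coordinates, the
first index being the column (from left to right), the second one the row (from bottom to top).
As the indices start at `0`, the cell `(k, l)` is the square `[k, k + 1] × [l, l + 1]`. -/
def standardFigure {t s : ℕ} (M : Matrix (Fin t) (Fin s) SignType) : Set (ℝ × ℝ) :=
  {p | ∃ (k : Fin t) (l : Fin s),
    (M k l = 1 ∧ p ∈ segment ℝ (((k : ℕ) : ℝ), ((l : ℕ) : ℝ)) ((k : ℕ) + 1, (l : ℕ) + 1)) ∨
    (M k l = -1 ∧ p ∈ segment ℝ (((k : ℕ) : ℝ), ((l : ℕ) : ℝ) + 1) ((k : ℕ) + 1, (l : ℕ)))}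

/-- The geometric grid class of `M`: the permutations in the same relative order as some finite
independent subset of the standard figure of `M`. -/
def Geom {t s : ℕ} (M : Matrix (Fin t) (Fin s) SignType) : Set FinPerm :=
  {π | ∃ S : Set (ℝ × ℝ), S ⊆ standardFigure M ∧ S.Finite ∧ Independent S ∧
    SameRelativeOrder (plot π) S}

end GeomGrid

namespace GeomGrid

/-! Every point of the standard figure has both coordinates at the same distance from the integers.
List the entries of a drawn permutation by increasing distance and record for each its quarter cell
and its label: this word determines the labeled permutation, since within a half-unit interval the
distance is monotone in the coordinate (`lt_iff_precedesOnLine`). Quarter cells form a finite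
alphabet, so Higman's lemma yields an embedding of one word into a later one, and that embedding
preserves both the position order and the value order. -/

/-- Distance from a real number to the nearest integer. -/
noncomputable def intDist (x : ℝ) : ℝ := |x - round x|

theorem intDist_eq_min (x : ℝ) : intDist x = min (Int.fract x) (1 - Int.fract x) :=
  abs_sub_round_eq_min x

theorem intDist_add_intCast (x : ℝ) (k : ℤ) : intDist (x + k) = intDist x := by
  simp [intDist_eq_min]

theorem intDist_neg (x : ℝ) : intDist (-x) = intDist x := by
  rw [intDist_eq_min, intDist_eq_min]
  rcases eq_or_ne (Int.fract x) 0 with h | h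
  · rw [h, Int.fract_neg_eq_zero.2 h]
  · rw [Int.fract_neg h, sub_sub_cancel, min_comm]

/-- On the half-unit interval with index `m = ⌊2 * x⌋`, the distance to the nearest integer is
the distance to the left end of the interval if `m` is even, to the right end if `m` is odd. -/
theorem intDist_eq_ite (x : ℝ) :
    intDist x = if Even ⌊2 * x⌋ then x - ⌊2 * x⌋ / 2 else (⌊2 * x⌋ + 1) / 2 - x := by
  have h₁ := Int.floor_le (2 * x)
  have h₂ := Int.lt_floor_add_one (2 * x)
  rw [intDist_eq_min]
  generalize ⌊2 * x⌋ = m at h₁ h₂ ⊢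
  rcases Int.even_or_odd' m with ⟨k, rfl | rfl⟩
  · have hf : ⌊x⌋ = k := by
      rw [Int.floor_eq_iff]
      push_cast at h₁ h₂
      constructor <;> linarith
    push_cast at h₁ h₂ ⊢
    rw [if_pos (even_two_mul k), Int.fract, hf, min_eq_left (by linarith)]
    ring
  · have hf : ⌊x⌋ = k := by
      rw [Int.floor_eq_iff]
      push_cast at h₁ h₂
      constructor <;> linarith
    push_cast at h₁ h₂ ⊢
    rw [if_neg (by simp), Int.fract, hf, min_eq_right (by linarith)]
    ring

/-- For a sequence of distinct reals sorted by distance to the nearest integer, the order of two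
terms is determined by their half-unit intervals `p`, `q` and their ranks `a`, `b`. -/
def PrecedesOnLine {n : ℕ} (p q : ℤ) (a b : Fin n) : Prop :=
  p < q ∨ p = q ∧ if Even p then a < b else b < a

theorem precedesOnLine_map_iff {m n : ℕ} (φ : Fin m ↪o Fin n) (p q : ℤ) (a b : Fin m) :
    PrecedesOnLine p q (φ a) (φ b) ↔ PrecedesOnLine p q a b := by
  simp [PrecedesOnLine]

/-- Distance to the nearest integer increases along half-unit intervals of even index and decreases
along those of odd index. -/
theorem lt_iff_precedesOnLine {n : ℕ} {X : Fin n → ℝ} (hX : Function.Injective X)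
    (hd : Monotone (intDist ∘ X)) (a b : Fin n) :
    X a < X b ↔ PrecedesOnLine ⌊2 * X a⌋ ⌊2 * X b⌋ a b := by
  have key : ∀ a b, a < b → ⌊2 * X a⌋ = ⌊2 * X b⌋ →
      if Even ⌊2 * X a⌋ then X a < X b else X b < X a := by
    intro a b hab h
    -- The sorting is only weak, but a tie in distance within one half-unit interval would force
    -- equal terms.
    have hne : X a ≠ X b := hX.ne hab.ne
    have hle : intDist (X a) ≤ intDist (X b) := hd hab.le
    rw [intDist_eq_ite, intDist_eq_ite, ← h] at hle
    split_ifs at hle ⊢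
    · exact lt_of_le_of_ne (by linarith) hne
    · exact lt_of_le_of_ne (by linarith) hne.symm
  unfold PrecedesOnLine
  rcases lt_trichotomy ⌊2 * X a⌋ ⌊2 * X b⌋ with h | h | h
  · have : X a < X b := by
      by_contra! hba
      exact absurd (Int.floor_le_floor (by linarith : 2 * X b ≤ 2 * X a)) h.not_ge
    simp [h, this]
  · rcases lt_trichotomy a b with hab | rfl | hab
    · have := key a b hab h
      by_cases he : Even ⌊2 * X a⌋
      · rw [if_pos he] at this
        simp [h, h ▸ he, hab, this]
      · rw [if_neg he] at this
        simp [h, h ▸ he, hab.not_gt, this.not_gt]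
    · simp
    · have := key b a hab h.symm
      by_cases he : Even ⌊2 * X b⌋
      · rw [if_pos he] at this
        simp [h, he, hab.not_gt, this.not_gt]
      · rw [if_neg he] at this
        simp [h, he, hab, this]
  · have : ¬ X a < X b := fun hab =>
      absurd (Int.floor_le_floor (by linarith : 2 * X a ≤ 2 * X b)) h.not_ge
    simp [h.not_gt, h.ne', this]

/-- The quarter cell containing a point of the plane. -/
noncomputable def quarterCell (p : ℝ × ℝ) : ℤ × ℤ := (⌊2 * p.1⌋, ⌊2 * p.2⌋)

theorem exists_of_mem_standardFigure {t s : ℕ} {M : Matrix (Fin t) (Fin s) SignType} {p : ℝ × ℝ}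
    (hp : p ∈ standardFigure M) :
    ∃ (k : Fin t) (l : Fin s), ∃ u ∈ Set.Icc (0 : ℝ) 1,
      p = ((k : ℕ) + u, (l : ℕ) + u) ∨ p = ((k : ℕ) + u, (l : ℕ) + 1 - u) := by
  obtain ⟨k, l, ⟨-, h⟩ | ⟨-, h⟩⟩ := hp <;> rw [segment_eq_image'] at h <;>
    obtain ⟨u, hu, rfl⟩ := h <;> refine ⟨k, l, u, hu, ?_⟩
  · left
    ext <;> simp
  · right
    ext
    · simp
    · simp
      ring

/-- On a diagonal of a cell the coordinates are `u` and `±u` up to integers, and `intDist` ignores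
integer shifts and signs. -/
theorem intDist_fst_eq_snd {t s : ℕ} {M : Matrix (Fin t) (Fin s) SignType} {p : ℝ × ℝ}
    (hp : p ∈ standardFigure M) : intDist p.1 = intDist p.2 := by
  obtain ⟨k, l, u, -, rfl | rfl⟩ := exists_of_mem_standardFigure hp
  · have h₁ := intDist_add_intCast u (k : ℕ)
    have h₂ := intDist_add_intCast u (l : ℕ)
    push_cast at h₁ h₂
    simp only [add_comm _ u, h₁, h₂]
  · have h₁ := intDist_add_intCast u (k : ℕ)
    have h₂ := intDist_add_intCast (-u) ((l : ℕ) + 1)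
    push_cast at h₁ h₂
    simp only [add_comm _ u, h₁, sub_eq_neg_add, h₂, intDist_neg]

/-- The upper bounds are attained: a point with first coordinate `t` has index `2 * t`. -/
theorem quarterCell_mem {t s : ℕ} {M : Matrix (Fin t) (Fin s) SignType} {p : ℝ × ℝ}
    (hp : p ∈ standardFigure M) :
    quarterCell p ∈ Set.Icc (0 : ℤ) (2 * t) ×ˢ Set.Icc (0 : ℤ) (2 * s) := by
  have key : ∀ (n : ℕ) (i : Fin n) (v x : ℝ), 0 ≤ v → v ≤ 1 → x = (i : ℕ) + v →
      ⌊2 * x⌋ ∈ Set.Icc (0 : ℤ) (2 * n) := by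
    rintro n i v x h₀ h₁ rfl
    have hi : ((i : ℕ) : ℝ) + 1 ≤ n := by exact_mod_cast i.isLt
    have hi₀ : (0 : ℝ) ≤ (i : ℕ) := Nat.cast_nonneg _
    refine ⟨Int.floor_nonneg.2 (by linarith), ?_⟩
    rw [← Int.cast_le (R := ℝ)]
    push_cast
    exact (Int.floor_le _).trans (by linarith)
  obtain ⟨k, l, u, ⟨h₀, h₁⟩, rfl | rfl⟩ := exists_of_mem_standardFigure hp
  · exact ⟨key t k u _ h₀ h₁ rfl, key s l u _ h₀ h₁ rfl⟩
  · exact ⟨key t k u _ h₀ h₁ rfl, key s l (1 - u) _ (by linarith) (by linarith) (by ring)⟩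

/-- A permutation in `Geom M` is drawn on the standard figure of `M`, and its entries can be
listed by increasing distance to the integer lattice. -/
theorem exists_drawing {t s : ℕ} {M : Matrix (Fin t) (Fin s) SignType} {π : FinPerm}
    (hπ : π ∈ Geom M) :
    ∃ (X Y : Fin π.1 → ℝ) (τ : Equiv.Perm (Fin π.1)),
      (∀ i j, X i < X j ↔ i < j) ∧ (∀ i j, Y i < Y j ↔ π.2 i < π.2 j) ∧
      Monotone (intDist ∘ X ∘ τ) ∧ Monotone (intDist ∘ Y ∘ τ) ∧
      ∀ i, (X i, Y i) ∈ standardFigure M := by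
  obtain ⟨S, hS, -, -, f, g, hfg⟩ := hπ
  have hmem : ∀ i : Fin π.1, (f ((i : ℕ) + 1), g ((π.2 i : ℕ) + 1)) ∈ standardFigure M :=
    fun i => hS (hfg ▸ ⟨_, ⟨i, rfl⟩, rfl⟩)
  refine ⟨fun i => f ((i : ℕ) + 1), fun i => g ((π.2 i : ℕ) + 1),
    Tuple.sort (intDist ∘ fun i : Fin π.1 => f ((i : ℕ) + 1)), fun i j => by simp,
    fun i j => by simp, Tuple.monotone_sort (intDist ∘ fun i : Fin π.1 => f ((i : ℕ) + 1)), ?_,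
    hmem⟩
  -- One sorting permutation serves both axes.
  have heq : (intDist ∘ fun i : Fin π.1 => g ((π.2 i : ℕ) + 1)) =
      intDist ∘ fun i : Fin π.1 => f ((i : ℕ) + 1) :=
    funext fun i => (intDist_fst_eq_snd (hmem i)).symm
  rw [← Function.comp_assoc, heq]
  exact Tuple.monotone_sort _

/-- A sublist relation between words yields an order embedding of their index sets. -/
theorem exists_orderEmbedding_of_sublistForall₂ {α β : Type*} {r : α → β → Prop} {m n : ℕ}
    {v : Fin m → α} {w : Fin n → β} (h : List.SublistForall₂ r (List.ofFn v) (List.ofFn w)) :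
    ∃ φ : Fin m ↪o Fin n, ∀ a, r (v a) (w (φ a)) := by
  obtain ⟨l, hl, hsub⟩ := List.sublistForall₂_iff.1 h
  obtain ⟨f, hf⟩ := List.sublist_iff_exists_fin_orderEmbedding_get_eq.1 hsub
  obtain ⟨hlen, hr⟩ := List.forall₂_iff_get.1 hl
  have hm : m = l.length := by simpa using hlen
  have hn : (List.ofFn w).length = n := List.length_ofFn
  refine ⟨((Fin.castOrderIso hm).toOrderEmbedding.trans f).trans
    (Fin.castOrderIso hn).toOrderEmbedding, fun a => ?_⟩
  have h₁ := hr a (by simp) (by simp [← hm])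
  have h₂ := hf (Fin.cast hm a)
  simp only [List.get_eq_getElem, List.getElem_ofFn, Fin.val_cast] at h₁ h₂
  rw [h₂] at h₁
  exact h₁

theorem isLWQO_geom {t s : ℕ} (M : Matrix (Fin t) (Fin s) SignType) :
    IsLWQO.{u} (Geom M) := by
  intro L _ _
  let T : Set (ℤ × ℤ) := Set.Icc (0 : ℤ) (2 * t) ×ˢ Set.Icc (0 : ℤ) (2 * s)
  have : Finite T := ((Set.finite_Icc _ _).prod (Set.finite_Icc _ _)).to_subtype
  -- Cells must agree exactly, which is still wqo because `T` is finite; only labels may grow.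
  let r : T × L → T × L → Prop := fun a b => a.1 = b.1 ∧ a.2 ≤ b.2
  have : IsPreorder (T × L) r :=
    { refl := fun a => ⟨rfl, le_rfl⟩
      trans := fun a b c hab hbc => ⟨hab.1.trans hbc.1, hab.2.trans hbc.2⟩ }
  have hr : WellQuasiOrdered r :=
    (Finite.wellQuasiOrdered (Eq : T → T → Prop)).prod (wellQuasiOrdered_le (α := L))
  have higman := Set.PartiallyWellOrderedOn.partiallyWellOrderedOn_sublistForall₂ r
    (Set.partiallyWellOrderedOn_univ_iff.2 hr)
  refine ⟨fun x => ?_⟩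
  choose X Y τ hX hY hdX hdY hfig using fun n => exists_drawing (x n).2
  have hXi : ∀ n, Function.Injective (X n ∘ τ n) := fun n =>
    Function.Injective.comp (fun i j h =>
      le_antisymm (not_lt.1 fun hlt => ((hX n j i).2 hlt).ne' h)
        (not_lt.1 fun hlt => ((hX n i j).2 hlt).ne h)) (τ n).injective
  have hYi : ∀ n, Function.Injective (Y n ∘ τ n) := fun n =>
    Function.Injective.comp (fun i j h => (x n).1.toPerm.2.injective <|
      le_antisymm (not_lt.1 fun hlt => ((hY n j i).2 hlt).ne' h)
        (not_lt.1 fun hlt => ((hY n i j).2 hlt).ne h)) (τ n).injective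
  let w : ∀ n, Fin (x n).1.toPerm.1 → T × L := fun n a =>
    (⟨quarterCell (X n (τ n a), Y n (τ n a)), quarterCell_mem (hfig n _)⟩, (x n).1.label (τ n a))
  obtain ⟨m, n, hmn, h⟩ := higman fun n => ⟨List.ofFn (w n), fun _ _ => Set.mem_univ _⟩
  obtain ⟨φ, hφ⟩ := exists_orderEmbedding_of_sublistForall₂ h
  have hcell : ∀ a, ⌊2 * X m (τ m a)⌋ = ⌊2 * X n (τ n (φ a))⌋ ∧
      ⌊2 * Y m (τ m a)⌋ = ⌊2 * Y n (τ n (φ a))⌋ := fun a =>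
    Prod.ext_iff.1 (Subtype.ext_iff.1 (hφ a).1)
  have hXlt : ∀ a b, τ m a < τ m b ↔ τ n (φ a) < τ n (φ b) := fun a b => by
    rw [← hX m, ← hX n]
    refine (lt_iff_precedesOnLine (hXi m) (hdX m) a b).trans
      (Iff.trans ?_ (lt_iff_precedesOnLine (hXi n) (hdX n) (φ a) (φ b)).symm)
    simp only [Function.comp_apply, precedesOnLine_map_iff, (hcell _).1]
  have hYlt : ∀ a b, (x m).1.toPerm.2 (τ m a) < (x m).1.toPerm.2 (τ m b) ↔
      (x n).1.toPerm.2 (τ n (φ a)) < (x n).1.toPerm.2 (τ n (φ b)) := fun a b => by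
    rw [← hY m, ← hY n]
    refine (lt_iff_precedesOnLine (hYi m) (hdY m) a b).trans
      (Iff.trans ?_ (lt_iff_precedesOnLine (hYi n) (hdY n) (φ a) (φ b)).symm)
    simp only [Function.comp_apply, precedesOnLine_map_iff, (hcell _).2]
  -- `φ` acts on ranks by distance; conjugating with the sortings turns it into a map of positions.
  have he : StrictMono fun i => τ n (φ ((τ m).symm i)) := fun i j hij => by
    rw [← hXlt]
    simpa using hij
  refine ⟨m, n, hmn, OrderEmbedding.ofStrictMono _ he, fun i j => ?_, fun j => ?_⟩
  · simpa using hYlt ((τ m).symm i) ((τ m).symm j)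
  · simpa [w] using (hφ ((τ m).symm j)).2

end GeomGrid

theorem mainTheorem3 {t s : ℕ} (M : Matrix (Fin t) (Fin s) SignType) :
    GeomGrid.IsLWQO.{u} (GeomGrid.Geom M) :=
  GeomGrid.isLWQO_geom M
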